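/- Let $n\ge 1$, let $\Omega\subset\mathbb R^n$ be a bounded open set, $\mathcal Y>0$, $s\in(0,1)$, $\alpha=1-2s$ and $d_s=2^{\alpha}\Gamma(1-s)/\Gamma(s)$. Let $A:\Omega\to\mathbb R^{n\times n}$ be Lipschitz continuous, symmetric and uniformly positive definite, let $0\le c\in L^\infty(\Omega)$, and set $\mathbf A=\mathrm{diag}(A,1)$ and $\mathcal C_{\mathcal Y}=\Omega\times(0,\mathcal Y)$, with points $(x',y)$. Let $\mathsf a,\mathsf b,\mathsf u_d\in L^2(\Omega)$ with $\mathsf a\le\mathsf b$ a.e. in $\Omega$, let $\mu>0$, and put $$\mathsf Z_{ad}=\{\mathsf r\in L^2(\Omega):\ \mathsf a\le \mathsf r\le \mathsf b\ \text{a.e. in }\Omega\},\qquad J(\mathsf u,\mathsf r)=\tfrac12\|\mathsf u-\mathsf u_d\|_{L^2(\Omega)}^2+\tfrac{\mu}{2}\|\mathsf r\|_{L^2(\Omega)}^2 .$$ Let $H^1(y^\alpha,\mathcal C_{\mathcal Y})$ be the space of functions $w$ which, together with their distributional gradient $\nabla w$, are square integrable on $\mathcal C_{\mathcal Y}$ with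 respect to $y^\alpha\,dx'\,dy$. Let $H_L=\{w\in H^1(y^\alpha,\mathcal C_{\mathcal Y}): w=0 \text{ on } \partial\Omega\times[0,\mathcal Y]\cup\Omega\times\{\mathcal Y\}\}$, where vanishing means that $w$ is a limit in $H^1(y^\alpha,\mathcal C_{\mathcal Y})$ of restrictions of functions in $C_c^\infty(\Omega\times(-\infty,\mathcal Y))$, and let $\mathrm{tr}\,w\in L^2(\Omega)$ be the trace of $w\in H_L$ on $\Omega\times\{0\}$ (the continuous extension of $\varphi\mapsto\varphi(\cdot,0)$). For $w,\phi\in H_L$ define $$a_{\mathcal Y}(w,\phi)=\frac1{d_s}\int_{\mathcal C_{\mathcal Y}} y^\alpha\,\mathbf A\nabla w\cdot\nabla\phi+y^\alpha c\,w\,\phi .$$ The truncated optimal control problem is to minimize $J(\mathrm{tr}\,v,\mathsf r)$ over all pairs $(v,\mathsf r)\in H_L\times\mathsf Z_{ad}$ that satisfy the state equation $$a_{\mathcal Y}(v,\phi)=(\mathsf r,\mathrm{tr}\,\phi)_{L^2(\Omega)}\qquad\forall \phi\in H_L. \tag{1}$$ Then this problem has a unique solution $(\bar v,\bar{\mathsf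 r})\in H_L\times\mathsf Z_{ad}$. Moreover, the following optimality system is necessary and sufficient. If $(\bar v,\bar{\mathsf r})$ is optimal, then there is a unique $\bar p$ such that $(\bar v,\bar p,\bar{\mathsf r})$ satisfies the system below; conversely, if $(\bar v,\bar p,\bar{\mathsf r})$ satisfies the system below, then $(\bar v,\bar{\mathsf r})$ is optimal: $$\begin{cases} \bar v\in H_L \text{ solves (1) with } \mathsf r=\bar{\mathsf r},\\ \bar p\in H_L,\quad a_{\mathcal Y}(\bar p,\phi)=(\mathrm{tr}\,\bar v-\mathsf u_d,\mathrm{tr}\,\phi)_{L^2(\Omega)}\quad\forall\phi\in H_L,\\ \bar{\mathsf r}\in\mathsf Z_{ad},\quad(\mathrm{tr}\,\bar p+\mu\bar{\mathsf r},\mathsf r-\bar{\mathsf r})_{L^2(\Omega)}\ge0\quad\forall\mathsf r\in\mathsf Z_{ad}. \end{cases}$$ -/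

import Mathlib

open MeasureTheory Set
open scoped ENNReal ContDiff

noncomputable section

namespace TruncControl

/-- Vectors `ξ = (ξ', ξ_y)` of `ℝⁿ × ℝ = ℝⁿ⁺¹` with the Euclidean norm and inner product. -/
abbrev Vec (n : ℕ) := WithLp 2 (EuclideanSpace ℝ (Fin n) × ℝ)

/-- `L²(Ω)`. -/
abbrev L2 {n : ℕ} (Ω : Set (EuclideanSpace ℝ (Fin n))) := Lp ℝ 2 (volume.restrict Ω)

/-- The truncated cylinder `Ω × (0, Y)`. Its points are `(x', y)`. -/
def cyl {n : ℕ} (Ω : Set (EuclideanSpace ℝ (Fin n))) (Y : ℝ) :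
    Set (EuclideanSpace ℝ (Fin n) × ℝ) := Ω ×ˢ Ioo 0 Y

/-- The measure `y ^ α dx' dy` on the truncated cylinder, where `α = 1 - 2 s`. -/
def wMeasure {n : ℕ} (Ω : Set (EuclideanSpace ℝ (Fin n))) (Y s : ℝ) :
    Measure (EuclideanSpace ℝ (Fin n) × ℝ) :=
  (volume.restrict (cyl Ω Y)).withDensity fun p => ENNReal.ofReal (p.2 ^ (1 - 2 * s))

/-- Pairs `(w, g)` of a function and a vector field in the weighted space `L²(y ^ α, Ω × (0, Y))`,
with the norm `(‖w‖² + ‖g‖²) ^ (1 / 2)`. A Sobolev function `w` is recorded as `(w, ∇ w)`. -/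
abbrev Pairs {n : ℕ} (Ω : Set (EuclideanSpace ℝ (Fin n))) (Y s : ℝ) :=
  WithLp 2 (Lp ℝ 2 (wMeasure Ω Y s) × Lp (Vec n) 2 (wMeasure Ω Y s))

/-- The classical gradient `(∇_{x'} φ, ∂_y φ)`. -/
def grad {n : ℕ} (φ : EuclideanSpace ℝ (Fin n) × ℝ → ℝ) (p : EuclideanSpace ℝ (Fin n) × ℝ) :
    Vec n :=
  WithLp.toLp 2
    (WithLp.toLp 2 fun i => fderiv ℝ φ p (EuclideanSpace.single i 1, 0), fderiv ℝ φ p (0, 1))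

/-- `C_c^∞(U)`: smooth functions on `ℝⁿ × ℝ` with compact support inside `U`. -/
def testFunctions {n : ℕ} (U : Set (EuclideanSpace ℝ (Fin n) × ℝ)) :
    Set (EuclideanSpace ℝ (Fin n) × ℝ → ℝ) :=
  {φ | ContDiff ℝ ∞ φ ∧ HasCompactSupport φ ∧ tsupport φ ⊆ U}

/-- `g` is the distributional gradient of `w` on `Ω × (0, Y)`. -/
def IsWeakGrad {n : ℕ} (Ω : Set (EuclideanSpace ℝ (Fin n))) (Y : ℝ)
    (w : EuclideanSpace ℝ (Fin n) × ℝ → ℝ) (g : EuclideanSpace ℝ (Fin n) × ℝ → Vec n) : Prop :=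
  ∀ ψ ∈ testFunctions (cyl Ω Y),
    ∫ p in cyl Ω Y, w p • grad ψ p = - ∫ p in cyl Ω Y, ψ p • g p

/-- The weighted Sobolev space `H¹(y ^ α, Ω × (0, Y))`. -/
def H1 {n : ℕ} (Ω : Set (EuclideanSpace ℝ (Fin n))) (Y s : ℝ) : Set (Pairs Ω Y s) :=
  {u | IsWeakGrad Ω Y u.fst u.snd}

/-- The element `u` is (the restriction to `Ω × (0, Y)` of) the smooth function `φ`. -/
def Represents {n : ℕ} {Ω : Set (EuclideanSpace ℝ (Fin n))} {Y s : ℝ}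
    (φ : EuclideanSpace ℝ (Fin n) × ℝ → ℝ) (u : Pairs Ω Y s) : Prop :=
  u.fst =ᵐ[wMeasure Ω Y s] φ ∧ u.snd =ᵐ[wMeasure Ω Y s] grad φ

/-- The functions of `H¹(y ^ α, Ω × (0, Y))` that vanish on `∂Ω × [0, Y]` and on `Ω × {Y}`:
those that are limits, in the norm of this space, of smooth functions vanishing near these two
parts of the boundary (and unconstrained at `y = 0`). -/
def HL {n : ℕ} (Ω : Set (EuclideanSpace ℝ (Fin n))) (Y s : ℝ) : Set (Pairs Ω Y s) :=
  {u | u ∈ H1 Ω Y s ∧ u ∈ closure {v | ∃ φ ∈ testFunctions (Ω ×ˢ Iio Y), Represents φ v}}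

/-- `z ∈ L²(Ω)` is the trace of `u` on `Ω × {0}`: the pair `(u, z)` is a limit of pairs
`(φ, φ(·, 0))` with `φ` smooth and vanishing near `∂Ω × [0, Y]` and `Ω × {Y}`. -/
def IsTrace {n : ℕ} {Ω : Set (EuclideanSpace ℝ (Fin n))} {Y s : ℝ}
    (u : Pairs Ω Y s) (z : L2 Ω) : Prop :=
  (u, z) ∈ closure {q : Pairs Ω Y s × L2 Ω | ∃ φ ∈ testFunctions (Ω ×ˢ Iio Y),
    Represents φ q.1 ∧ q.2 =ᵐ[volume.restrict Ω] fun x => φ (x, 0)}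

/-- The trace operator on `Ω × {0}`. -/
def tr {n : ℕ} {Ω : Set (EuclideanSpace ℝ (Fin n))} {Y s : ℝ} (u : Pairs Ω Y s) : L2 Ω :=
  Classical.epsilon (IsTrace u)

/-- `d_s = 2 ^ α Γ(1 - s) / Γ(s)` with `α = 1 - 2 s`. -/
def dConst (s : ℝ) : ℝ := 2 ^ (1 - 2 * s) * Real.Gamma (1 - s) / Real.Gamma s

/-- The action on `ξ` of the block matrix `diag (M, 1)`. -/
def extMul {n : ℕ} (M : Matrix (Fin n) (Fin n) ℝ) (ξ : Vec n) : Vec n :=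
  WithLp.toLp 2 (Matrix.toEuclideanLin M ξ.fst, ξ.snd)

/-- The bilinear form
`(1 / d_s) ∫_{Ω × (0, Y)} y ^ α diag (A, 1) ∇ w ⬝ ∇ φ + y ^ α c w φ`. -/
def form {n : ℕ} {Ω : Set (EuclideanSpace ℝ (Fin n))} {Y s : ℝ}
    (A : EuclideanSpace ℝ (Fin n) → Matrix (Fin n) (Fin n) ℝ) (c : EuclideanSpace ℝ (Fin n) → ℝ)
    (w φ : Pairs Ω Y s) : ℝ :=
  1 / dConst s * ∫ p, (inner ℝ (extMul (A p.1) (w.snd p)) (φ.snd p)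
    + c p.1 * w.fst p * φ.fst p) ∂(wMeasure Ω Y s)

/-- `v` is a weak solution, in the space `HL`, of the problem with Neumann datum `f ∈ L²(Ω)` at
`y = 0`: `form v φ = (f, tr φ)` for all `φ`. -/
def Solves {n : ℕ} {Ω : Set (EuclideanSpace ℝ (Fin n))} {Y s : ℝ}
    (A : EuclideanSpace ℝ (Fin n) → Matrix (Fin n) (Fin n) ℝ) (c : EuclideanSpace ℝ (Fin n) → ℝ)
    (f : L2 Ω) (v : Pairs Ω Y s) : Prop :=
  v ∈ HL Ω Y s ∧ ∀ φ ∈ HL Ω Y s, form A c v φ = inner ℝ f (tr φ)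

/-- The admissible controls: `a ≤ r ≤ b` almost everywhere in `Ω`. -/
def Zad {n : ℕ} {Ω : Set (EuclideanSpace ℝ (Fin n))} (a b : L2 Ω) : Set (L2 Ω) :=
  {r | ∀ᵐ x ∂(volume.restrict Ω), a x ≤ r x ∧ r x ≤ b x}

/-- The cost `J(u, z) = ½ ‖u - u_d‖² + (μ / 2) ‖z‖²`, norms in `L²(Ω)`. -/
def cost {n : ℕ} {Ω : Set (EuclideanSpace ℝ (Fin n))} (ud : L2 Ω) (mu : ℝ) (u z : L2 Ω) : ℝ :=
  1 / 2 * ‖u - ud‖ ^ 2 + mu / 2 * ‖z‖ ^ 2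

/-- `(v, r)` is an optimal state-control pair of the truncated control problem. -/
def IsOptimal {n : ℕ} {Ω : Set (EuclideanSpace ℝ (Fin n))} {Y s : ℝ}
    (A : EuclideanSpace ℝ (Fin n) → Matrix (Fin n) (Fin n) ℝ) (c : EuclideanSpace ℝ (Fin n) → ℝ)
    (a b ud : L2 Ω) (mu : ℝ) (v : Pairs Ω Y s) (r : L2 Ω) : Prop :=
  r ∈ Zad a b ∧ Solves A c r v ∧
    ∀ (v' : Pairs Ω Y s) (r' : L2 Ω), r' ∈ Zad a b → Solves A c r' v' →
      cost ud mu (tr v) r ≤ cost ud mu (tr v') r'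

/-- The optimality system: state equation, adjoint equation and variational inequality. -/
def OptimalitySystem {n : ℕ} {Ω : Set (EuclideanSpace ℝ (Fin n))} {Y s : ℝ}
    (A : EuclideanSpace ℝ (Fin n) → Matrix (Fin n) (Fin n) ℝ) (c : EuclideanSpace ℝ (Fin n) → ℝ)
    (a b ud : L2 Ω) (mu : ℝ) (v p : Pairs Ω Y s) (r : L2 Ω) : Prop :=
  Solves A c r v ∧ Solves A c (tr v - ud) p ∧
    r ∈ Zad a b ∧ ∀ q ∈ Zad a b, 0 ≤ inner ℝ (tr p + mu • r) (q - r)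

end TruncControl

end

/-! The gradient controls everything on `HL`. A test function vanishes near `y = Y`, so each slice
is an integral of `∂_y φ`; Cauchy–Schwarz against the weight bounds every slice in `L²(Ω)` by the
weighted gradient norm, because `y ^ (-α)` is integrable for `s > 0` (`lintegral_slice_le`). The
slice `y = 0` gives the trace bound; averaging the slices against `y ^ α`, integrable for `s < 1`,
gives a Poincaré inequality. Both pass to limits (`exists_bounds`), so the trace is well defined and
the form is coercive on the closed subspace `HL`.

Lax–Milgram then gives a solution operator `S` with `T = tr ∘ S` bounded, and symmetric because the
form is (`exists_controlToState`). The adjoint equation is solved by the same `S`, so the optimality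
system reduces to a variational inequality for `r` alone. The reduced cost is half a squared
distance, so this inequality is solved by a Hilbert space projection
(`exists_variationalInequality`). Any solution satisfies a quadratic growth estimate
(`reducedCost_growth`), which yields optimality and, since `mu > 0`, uniqueness. Necessity follows
from uniqueness, without differentiating the cost. -/

namespace TruncControl

/-! ### Abstract linear-quadratic control in Hilbert space -/

section Abstract

variable {H V : Type*} [NormedAddCommGroup H] [InnerProductSpace ℝ H]
  [NormedAddCommGroup V] [InnerProductSpace ℝ V]

theorem exists_bilin_inner (M : H →L[ℝ] H) (P : V →L[ℝ] H) :
    ∃ B : V →L[ℝ] V →L[ℝ] ℝ, ∀ w φ, B w φ = inner ℝ (M (P w)) (P φ) :=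
  ⟨(innerSL ℝ : H →L[ℝ] H →L[ℝ] ℝ).bilinearComp (M ∘L P) P, fun _ _ => rfl⟩

/-- Lax-Milgram: the solution operator of `B v φ = (f, T φ)`. -/
theorem exists_solutionOperator [CompleteSpace H] [CompleteSpace V] {B : V →L[ℝ] V →L[ℝ] ℝ}
    (hB : IsCoercive B) (T : V →L[ℝ] H) :
    ∃ S : H →L[ℝ] V, ∀ f v, (∀ φ, B v φ = inner ℝ f (T φ)) ↔ v = S f := by
  refine ⟨hB.continuousLinearEquivOfBilin.symm.toContinuousLinearMap ∘L T.adjoint,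
    fun f v => ⟨fun h => ?_, ?_⟩⟩
  · have := hB.unique_continuousLinearEquivOfBilin (v := v) (f := T.adjoint f) fun w => by
      rw [h, ContinuousLinearMap.adjoint_inner_left]
    simp [this]
  · rintro rfl φ
    rw [← hB.continuousLinearEquivOfBilin_apply]
    simp [ContinuousLinearMap.adjoint_inner_left]

/-- Both sides equal `B (S f) (S g)`, up to symmetry of `B`. This is why the adjoint equation needs
no second solution operator. -/
theorem solutionOperator_selfAdjoint {B : V →L[ℝ] V →L[ℝ] ℝ} (hB : ∀ u v, B u v = B v u)
    {T : V →L[ℝ] H} {S : H →L[ℝ] V} (hS : ∀ f φ, B (S f) φ = inner ℝ f (T φ)) (f g : H) :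
    inner ℝ ((T ∘L S) f) g = inner ℝ f ((T ∘L S) g) := by
  simp only [ContinuousLinearMap.comp_apply]
  rw [real_inner_comm, ← hS, ← hS, hB]

/-- The variational inequality for the reduced cost implies quadratic growth. -/
theorem reducedCost_growth {T : H →L[ℝ] H} (hT : ∀ f g, inner ℝ (T f) g = inner ℝ f (T g))
    (ud : H) (mu : ℝ) {r q : H} (h : 0 ≤ inner ℝ (T (T r - ud) + mu • r) (q - r)) :
    (1 / 2 * ‖T r - ud‖ ^ 2 + mu / 2 * ‖r‖ ^ 2) + mu / 2 * ‖q - r‖ ^ 2 ≤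
      1 / 2 * ‖T q - ud‖ ^ 2 + mu / 2 * ‖q‖ ^ 2 := by
  have h1 : ‖T q - ud‖ ^ 2 = ‖T r - ud‖ ^ 2 + 2 * inner ℝ (T r - ud) (T (q - r))
      + ‖T (q - r)‖ ^ 2 := by
    rw [← norm_add_sq_real]; congr 2; simp
  have h2 : ‖q‖ ^ 2 = ‖r‖ ^ 2 + 2 * inner ℝ r (q - r) + ‖q - r‖ ^ 2 := by
    rw [← norm_add_sq_real]; simp
  rw [inner_add_left, real_inner_smul_left, hT] at h
  rw [h1, h2]
  -- The expansion is exact: the linear term is `h`, and only the nonnegative term `1 / 2 * ‖T (q -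
  -- r)‖ ^ 2` is discarded.
  nlinarith [sq_nonneg ‖T (q - r)‖]

/-- The variational inequality for the reduced cost has a solution. -/
theorem exists_variationalInequality [CompleteSpace H] {T : H →L[ℝ] H}
    (hT : ∀ f g, inner ℝ (T f) g = inner ℝ f (T g)) (ud : H) {mu : ℝ} (hmu : 0 < mu) {K : Set H}
    (hK : IsClosed K) (hKc : Convex ℝ K) (hKn : K.Nonempty) :
    ∃ r ∈ K, ∀ q ∈ K, 0 ≤ inner ℝ (T (T r - ud) + mu • r) (q - r) := by
  -- The reduced cost of `r` is half the squared distance from `E r` to `(ud, 0)`; hence the factor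
  -- `√mu`. Minimizing it over `K` is projecting `(ud, 0)` onto `E '' K`.
  let E : H →ₗ[ℝ] WithLp 2 (H × H) :=
    { toFun := fun r => WithLp.toLp 2 (T r, Real.sqrt mu • r)
      map_add' := fun x y => by
        apply (WithLp.equiv 2 (H × H)).injective; simp
      map_smul' := fun t x => by
        apply (WithLp.equiv 2 (H × H)).injective; simp [smul_comm t] }
  have hE : ∀ r, ‖E r‖ ^ 2 = ‖T r‖ ^ 2 + mu * ‖r‖ ^ 2 := fun r => by
    rw [WithLp.prod_norm_sq_eq_of_L2]
    simp [E, norm_smul, mul_pow, Real.sq_sqrt hmu.le, abs_of_nonneg (Real.sqrt_nonneg mu)]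
  have hcont : Continuous E := by
    change Continuous fun r => WithLp.toLp 2 (T r, Real.sqrt mu • r)
    fun_prop
  -- `‖E x‖ ≥ √mu ‖x‖`, so the image of the complete set `K` is complete and the projection exists.
  have hanti : AntilipschitzWith (Real.toNNReal (Real.sqrt mu)⁻¹) E := by
    refine AddMonoidHomClass.antilipschitz_of_bound E fun x => ?_
    have h0 : 0 < Real.sqrt mu := Real.sqrt_pos.2 hmu
    rw [Real.coe_toNNReal _ (by positivity), inv_mul_eq_div, le_div_iff₀ h0]
    refine le_of_sq_le_sq ?_ (norm_nonneg _)
    rw [hE, mul_pow, Real.sq_sqrt hmu.le]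
    nlinarith [sq_nonneg ‖T x‖]
  have hcomp : IsComplete (E '' K) :=
    (hanti.isUniformInducing (ContinuousLinearMap.uniformContinuous ⟨E, hcont⟩)).isComplete_iff.2
      hK.isComplete
  have hconv : Convex ℝ (E '' K) := hKc.linear_image E
  obtain ⟨_, ⟨r, hr, rfl⟩, hmin⟩ := exists_norm_eq_iInf_of_complete_convex (hKn.image E) hcomp
    hconv (WithLp.toLp 2 (ud, 0))
  refine ⟨r, hr, fun q hq => ?_⟩
  have := (norm_eq_iInf_iff_real_inner_le_zero hconv ⟨r, hr, rfl⟩).1 hmin _ ⟨q, hq, rfl⟩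
  rw [WithLp.prod_inner_apply] at this
  simp only [E, LinearMap.coe_mk, AddHom.coe_mk, WithLp.ofLp_sub, Prod.fst_sub, Prod.snd_sub,
    zero_sub, ← smul_sub, inner_neg_left, real_inner_smul_left, real_inner_smul_right] at this
  rw [inner_add_left, real_inner_smul_left, hT, map_sub]
  rw [← neg_sub (T r) ud, inner_neg_left, ← mul_assoc, Real.mul_self_sqrt hmu.le] at this
  linarith

end Abstract

/-! ### The weight `y ^ α` and estimates for test functions -/

section Weight

variable {n : ℕ} {Ω : Set (EuclideanSpace ℝ (Fin n))} {Y s : ℝ}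

theorem lintegral_rpow_Ioo_lt_top {r : ℝ} (hr : -1 < r) (Y : ℝ) :
    ∫⁻ t in Ioo 0 Y, ENNReal.ofReal (t ^ r) < ⊤ := by
  have h : IntegrableOn (fun t : ℝ => t ^ r) (Ioo 0 Y) := by
    rcases le_or_gt Y 0 with hY | hY
    · simp [Ioo_eq_empty_of_le hY]
    · exact ((intervalIntegrable_iff_integrableOn_Ioc_of_le hY.le).1
        (intervalIntegral.intervalIntegrable_rpow' hr)).mono_set Ioo_subset_Ioc_self
  exact (lintegral_mono fun t => Real.ofReal_le_enorm _).trans_lt h.2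

theorem wMeasure_eq_prod (Ω : Set (EuclideanSpace ℝ (Fin n))) (Y s : ℝ) :
    wMeasure Ω Y s = ((volume.restrict Ω).prod (volume.restrict (Ioo 0 Y))).withDensity
      fun p => ENNReal.ofReal (p.2 ^ (1 - 2 * s)) := by
  rw [wMeasure, cyl, Measure.prod_restrict, Measure.volume_eq_prod]

theorem measurable_weight (s : ℝ) : Measurable fun p : EuclideanSpace ℝ (Fin n) × ℝ =>
    ENNReal.ofReal (p.2 ^ (1 - 2 * s)) := by fun_prop

theorem lintegral_wMeasure (s : ℝ) {f : EuclideanSpace ℝ (Fin n) × ℝ → ℝ≥0∞} (hf : Measurable f) :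
    ∫⁻ p, f p ∂(wMeasure Ω Y s) =
      ∫⁻ x in Ω, ∫⁻ t in Ioo 0 Y, ENNReal.ofReal (t ^ (1 - 2 * s)) * f (x, t) := by
  rw [wMeasure_eq_prod, lintegral_withDensity_eq_lintegral_mul _ (measurable_weight s) hf,
    lintegral_prod _ ((measurable_weight s).mul hf).aemeasurable]
  rfl

theorem lintegral_wMeasure_symm (s : ℝ) {f : EuclideanSpace ℝ (Fin n) × ℝ → ℝ≥0∞}
    (hf : Measurable f) :
    ∫⁻ p, f p ∂(wMeasure Ω Y s) =
      ∫⁻ t in Ioo 0 Y, ENNReal.ofReal (t ^ (1 - 2 * s)) * ∫⁻ x in Ω, f (x, t) := by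
  rw [wMeasure_eq_prod, lintegral_withDensity_eq_lintegral_mul _ (measurable_weight s) hf,
    lintegral_prod_symm _ ((measurable_weight s).mul hf).aemeasurable]
  refine lintegral_congr fun t => ?_
  exact lintegral_const_mul (μ := volume.restrict Ω) (f := fun x => f (x, t))
    (ENNReal.ofReal (t ^ (1 - 2 * s))) (hf.comp measurable_prodMk_right)

/-- The exponent `1 - 2 * s` exceeds `-1` when `s < 1`. Finiteness makes bounded measurable fields
square integrable. -/
theorem isFiniteMeasure_wMeasure (hΩb : Bornology.IsBounded Ω) (hs1 : s < 1) :
    IsFiniteMeasure (wMeasure Ω Y s) := by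
  constructor
  have := lintegral_wMeasure_symm (Ω := Ω) (Y := Y) s (f := fun _ => 1) measurable_const
  rw [lintegral_one] at this
  rw [this, lintegral_mul_const _ (by fun_prop)]
  refine ENNReal.mul_lt_top (lintegral_rpow_Ioo_lt_top (r := 1 - 2 * s) (by linarith) Y) ?_
  simpa using hΩb.measure_lt_top

/-- Cauchy–Schwarz for the splitting `f = t ^ (-r / 2) * (t ^ (r / 2) * f)`. -/
theorem sq_lintegral_le_weighted {f : ℝ → ℝ≥0∞} (hf : Measurable f) (r Y : ℝ) :
    (∫⁻ t in Ioo 0 Y, f t) ^ 2 ≤ (∫⁻ t in Ioo 0 Y, ENNReal.ofReal (t ^ (-r))) *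
      ∫⁻ t in Ioo 0 Y, ENNReal.ofReal (t ^ r) * f t ^ 2 := by
  have hCS := ENNReal.lintegral_mul_le_Lp_mul_Lq (volume.restrict (Ioo 0 Y))
    Real.HolderConjugate.two_two
    (f := fun t => ENNReal.ofReal (t ^ (-r / 2))) (g := fun t => ENNReal.ofReal (t ^ (r / 2)) * f t)
    (by fun_prop) (by fun_prop)
  have e0 : ∫⁻ t in Ioo 0 Y, f t = ∫⁻ t in Ioo 0 Y, ((fun t => ENNReal.ofReal (t ^ (-r / 2))) *
      fun t => ENNReal.ofReal (t ^ (r / 2)) * f t) t := by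
    refine setLIntegral_congr_fun measurableSet_Ioo fun t ht => ?_
    simp only [Pi.mul_apply]
    rw [← mul_assoc, ← ENNReal.ofReal_mul (Real.rpow_nonneg ht.1.le _), ← Real.rpow_add ht.1]
    simp [neg_div]
  have e : ∀ q t : ℝ, 0 < t → ENNReal.ofReal (t ^ (q / 2)) ^ 2 = ENNReal.ofReal (t ^ q) := by
    intro q t ht
    rw [← ENNReal.ofReal_pow (Real.rpow_nonneg ht.le _), ← Real.rpow_natCast, ← Real.rpow_mul ht.le]
    congr 2; push_cast; ring
  have e1 : ∫⁻ t in Ioo 0 Y, ENNReal.ofReal (t ^ (-r / 2)) ^ (2 : ℝ) =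
      ∫⁻ t in Ioo 0 Y, ENNReal.ofReal (t ^ (-r)) := by
    refine setLIntegral_congr_fun measurableSet_Ioo fun t ht => ?_
    simp only [ENNReal.rpow_two, e _ _ ht.1]
  have e2 : ∫⁻ t in Ioo 0 Y, (ENNReal.ofReal (t ^ (r / 2)) * f t) ^ (2 : ℝ) =
      ∫⁻ t in Ioo 0 Y, ENNReal.ofReal (t ^ r) * f t ^ 2 := by
    refine setLIntegral_congr_fun measurableSet_Ioo fun t ht => ?_
    simp only [ENNReal.rpow_two, mul_pow, e _ _ ht.1]
  rw [← e0, e1, e2] at hCS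
  calc _ ≤ _ := pow_le_pow_left' hCS 2
    _ = _ := by
      rw [mul_pow, ← ENNReal.rpow_natCast, ← ENNReal.rpow_natCast, ← ENNReal.rpow_mul,
        ← ENNReal.rpow_mul]
      norm_num

theorem continuous_grad {φ : EuclideanSpace ℝ (Fin n) × ℝ → ℝ} (hφ : ContDiff ℝ ∞ φ) :
    Continuous (grad φ) := by
  have h : Continuous (fderiv ℝ φ) := hφ.continuous_fderiv (by simp)
  unfold grad
  fun_prop

/-- The fundamental theorem of calculus on `[y, Y]`: the support lies in `Ω ×ˢ Iio Y`, so `φ`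
vanishes at height `Y`. -/
theorem enorm_le_lintegral_fderiv {φ : EuclideanSpace ℝ (Fin n) × ℝ → ℝ}
    (hφ : φ ∈ testFunctions (Ω ×ˢ Iio Y)) (x : EuclideanSpace ℝ (Fin n)) {y : ℝ}
    (hy : y ∈ Icc 0 Y) :
    ‖φ (x, y)‖ₑ ≤ ∫⁻ t in Ioo 0 Y, ‖(grad φ (x, t)).snd‖ₑ := by
  obtain ⟨hd, -, hsupp⟩ := hφ
  have hY : φ (x, Y) = 0 := by
    refine image_eq_zero_of_notMem_tsupport fun h => ?_
    simpa using hsupp h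
  have hder : ∀ t, HasDerivAt (fun t => φ (x, t)) (grad φ (x, t)).snd t := fun t => by
    have h1 : HasFDerivAt φ (fderiv ℝ φ (x, t)) (x, t) :=
      (hd.differentiable (by simp) _).hasFDerivAt
    exact h1.comp_hasDerivAt t ((hasDerivAt_const t x).prodMk (hasDerivAt_id t))
  have hcont : Continuous fun t => (grad φ (x, t)).snd := by
    have := continuous_grad hd
    fun_prop
  have hint := intervalIntegral.integral_eq_sub_of_hasDerivAt (a := y) (b := Y)
    (fun t _ => hder t) (hcont.intervalIntegrable _ _)
  rw [hY, zero_sub, intervalIntegral.integral_of_le hy.2, integral_Ioc_eq_integral_Ioo] at hint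
  calc ‖φ (x, y)‖ₑ = ‖∫ t in Ioo y Y, (grad φ (x, t)).snd‖ₑ := by rw [hint, enorm_neg]
    _ ≤ ∫⁻ t in Ioo y Y, ‖(grad φ (x, t)).snd‖ₑ := enorm_integral_le_lintegral_enorm _
    _ ≤ _ := lintegral_mono_set (Ioo_subset_Ioo_left hy.1)

/-- Slices of test functions are controlled by the weighted norm of the gradient. -/
theorem lintegral_slice_le {φ : EuclideanSpace ℝ (Fin n) × ℝ → ℝ}
    (hφ : φ ∈ testFunctions (Ω ×ˢ Iio Y)) (hs0 : 0 < s) {y : ℝ} (hy : y ∈ Icc 0 Y) :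
    ∫⁻ x in Ω, ‖φ (x, y)‖ₑ ^ 2 ≤ (∫⁻ t in Ioo 0 Y, ENNReal.ofReal (t ^ (-(1 - 2 * s)))) *
      ∫⁻ p, ‖grad φ p‖ₑ ^ 2 ∂(wMeasure Ω Y s) := by
  have hg := continuous_grad hφ.1
  rw [lintegral_wMeasure s (f := fun p => ‖grad φ p‖ₑ ^ 2) (by fun_prop), ← lintegral_const_mul']
  · refine lintegral_mono fun x => ?_
    calc ‖φ (x, y)‖ₑ ^ 2 ≤ (∫⁻ t in Ioo 0 Y, ‖grad φ (x, t)‖ₑ) ^ 2 :=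
          pow_le_pow_left' ((enorm_le_lintegral_fderiv hφ x hy).trans
            (lintegral_mono fun t => WithLp.enorm_snd_le _ _)) 2
      _ ≤ _ := sq_lintegral_le_weighted (hg.comp (by fun_prop)).measurable.enorm _ _
  · exact (lintegral_rpow_Ioo_lt_top (by linarith) Y).ne

end Weight

/-! ### Trace and Poincaré bounds; existence and uniqueness of traces -/

section Trace

variable {n : ℕ} {Ω : Set (EuclideanSpace ℝ (Fin n))} {Y s : ℝ}

theorem enorm_sq_eq_lintegral {α E : Type*} [MeasurableSpace α] {ν : Measure α}
    [NormedAddCommGroup E] (f : Lp E 2 ν) : ‖f‖ₑ ^ 2 = ∫⁻ x, ‖f x‖ₑ ^ 2 ∂ν := by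
  have := eLpNorm_nnreal_pow_eq_lintegral (f := f) (μ := ν) (p := 2) two_ne_zero
  rw [Lp.enorm_def]
  simpa only [NNReal.coe_ofNat, ENNReal.coe_ofNat, ENNReal.rpow_two] using this

theorem norm_le_of_enorm_sq_le {E F : Type*} [NormedAddCommGroup E] [NormedAddCommGroup F]
    {x : E} {y : F} {C : ℝ≥0∞} (hC : C ≠ ⊤) (h : ‖x‖ₑ ^ 2 ≤ C * ‖y‖ₑ ^ 2) :
    ‖x‖ ^ 2 ≤ C.toReal * ‖y‖ ^ 2 := by
  have := ENNReal.toReal_mono (by finiteness) h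
  simpa using this

theorem tsupport_grad_subset (φ : EuclideanSpace ℝ (Fin n) × ℝ → ℝ) :
    tsupport (grad φ) ⊆ tsupport φ := by
  refine (closure_mono fun p hp => ?_).trans (tsupport_fderiv_subset ℝ)
  contrapose! hp
  simp only [Function.mem_support, not_not] at hp ⊢
  simp only [grad, hp]
  rfl

theorem hasCompactSupport_grad {φ : EuclideanSpace ℝ (Fin n) × ℝ → ℝ} (h : HasCompactSupport φ) :
    HasCompactSupport (grad φ) :=
  h.mono' ((subset_tsupport _).trans (tsupport_grad_subset φ))

theorem grad_add {φ ψ : EuclideanSpace ℝ (Fin n) × ℝ → ℝ} (hφ : ContDiff ℝ ∞ φ)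
    (hψ : ContDiff ℝ ∞ ψ) : grad (φ + ψ) = grad φ + grad ψ := by
  ext p : 1
  have h := fderiv_add (hφ.differentiable (by simp) p) (hψ.differentiable (by simp) p)
  simp only [grad, h]
  rfl

theorem grad_const_smul {φ : EuclideanSpace ℝ (Fin n) × ℝ → ℝ} (hφ : ContDiff ℝ ∞ φ) (t : ℝ) :
    grad (t • φ) = t • grad φ := by
  ext p : 1
  have h := fderiv_const_smul (hφ.differentiable (by simp) p) t
  simp only [grad, h]
  rfl

theorem add_mem_testFunctions {U : Set (EuclideanSpace ℝ (Fin n) × ℝ)}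
    {φ ψ : EuclideanSpace ℝ (Fin n) × ℝ → ℝ} (hφ : φ ∈ testFunctions U)
    (hψ : ψ ∈ testFunctions U) : φ + ψ ∈ testFunctions U :=
  ⟨hφ.1.add hψ.1, hφ.2.1.add hψ.2.1, (tsupport_add φ ψ).trans (union_subset hφ.2.2 hψ.2.2)⟩

theorem const_smul_mem_testFunctions {U : Set (EuclideanSpace ℝ (Fin n) × ℝ)}
    {φ : EuclideanSpace ℝ (Fin n) × ℝ → ℝ} (hφ : φ ∈ testFunctions U) (t : ℝ) :
    t • φ ∈ testFunctions U :=
  ⟨hφ.1.const_smul t, hφ.2.1.smul_left (f := fun _ => t),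
    (tsupport_smul_subset_right (fun _ => t) φ).trans hφ.2.2⟩

theorem zero_mem_testFunctions (U : Set (EuclideanSpace ℝ (Fin n) × ℝ)) :
    (0 : EuclideanSpace ℝ (Fin n) × ℝ → ℝ) ∈ testFunctions U :=
  ⟨contDiff_const, HasCompactSupport.zero, by simp⟩

variable (Ω Y s) in
/-- The pairs consisting of (the class of) a test function and its restriction to `y = 0`. -/
def testPairs : Submodule ℝ (Pairs Ω Y s × L2 Ω) where
  carrier := {q | ∃ φ ∈ testFunctions (Ω ×ˢ Iio Y),
    Represents φ q.1 ∧ q.2 =ᵐ[volume.restrict Ω] fun x => φ (x, 0)}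
  zero_mem' := by
    refine ⟨0, zero_mem_testFunctions _, ⟨Lp.coeFn_zero _ _ _, ?_⟩, Lp.coeFn_zero _ _ _⟩
    have h := grad_const_smul (n := n) (φ := 0) contDiff_const 0
    rw [zero_smul, zero_smul] at h
    rw [h]
    exact Lp.coeFn_zero _ _ _
  add_mem' := by
    rintro q q' ⟨φ, hφ, ⟨h1, h2⟩, h3⟩ ⟨φ', hφ', ⟨h1', h2'⟩, h3'⟩
    refine ⟨φ + φ', add_mem_testFunctions hφ hφ', ⟨?_, ?_⟩, ?_⟩
    · exact (Lp.coeFn_add _ _).trans (h1.add h1')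
    · rw [grad_add hφ.1 hφ'.1]
      exact (Lp.coeFn_add _ _).trans (h2.add h2')
    · exact (Lp.coeFn_add _ _).trans (h3.add h3')
  smul_mem' := by
    rintro t q ⟨φ, hφ, ⟨h1, h2⟩, h3⟩
    refine ⟨t • φ, const_smul_mem_testFunctions hφ t, ⟨?_, ?_⟩, ?_⟩
    · exact (Lp.coeFn_smul _ _).trans (h1.const_smul t)
    · rw [grad_const_smul hφ.1]
      exact (Lp.coeFn_smul _ _).trans (h2.const_smul t)
    · exact (Lp.coeFn_smul _ _).trans (h3.const_smul t)

theorem enorm_sq_snd_of_represents {φ : EuclideanSpace ℝ (Fin n) × ℝ → ℝ} {u : Pairs Ω Y s}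
    (h : Represents φ u) : ‖u.snd‖ₑ ^ 2 = ∫⁻ p, ‖grad φ p‖ₑ ^ 2 ∂(wMeasure Ω Y s) := by
  rw [enorm_sq_eq_lintegral]
  exact lintegral_congr_ae (h.2.mono fun p hp => by simp only [hp])

theorem exists_trace_bound (Ω : Set (EuclideanSpace ℝ (Fin n))) (hY : 0 < Y) (hs0 : 0 < s) :
    ∃ C : ℝ, 0 ≤ C ∧ ∀ q ∈ testPairs Ω Y s, ‖q.2‖ ^ 2 ≤ C * ‖q.1.snd‖ ^ 2 := by
  refine ⟨_, ENNReal.toReal_nonneg, fun q hq => norm_le_of_enorm_sq_le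
    (lintegral_rpow_Ioo_lt_top (r := -(1 - 2 * s)) (by linarith) Y).ne ?_⟩
  obtain ⟨φ, hφ, h1, h2⟩ := hq
  rw [enorm_sq_snd_of_represents h1, enorm_sq_eq_lintegral]
  refine (lintegral_congr_ae (h2.mono fun x hx => ?_)).trans_le
    (lintegral_slice_le hφ hs0 (left_mem_Icc.2 hY.le))
  simp only [hx]

/-- The slice bound is uniform in `y`, so it can be integrated against `y ^ α`. The constant is the
product of the integrals of `y ^ α` and `y ^ (-α)`, which are finite for `s < 1` and `s > 0`
respectively. -/
theorem exists_poincare_bound (Ω : Set (EuclideanSpace ℝ (Fin n))) (Y : ℝ) (hs0 : 0 < s)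
    (hs1 : s < 1) :
    ∃ C : ℝ, 0 ≤ C ∧ ∀ q ∈ testPairs Ω Y s, ‖q.1.fst‖ ^ 2 ≤ C * ‖q.1.snd‖ ^ 2 := by
  refine ⟨_, ENNReal.toReal_nonneg, fun q hq => norm_le_of_enorm_sq_le (ENNReal.mul_ne_top
    (lintegral_rpow_Ioo_lt_top (r := 1 - 2 * s) (by linarith) Y).ne
    (lintegral_rpow_Ioo_lt_top (r := -(1 - 2 * s)) (by linarith) Y).ne) ?_⟩
  obtain ⟨φ, hφ, h1, h2⟩ := hq
  rw [enorm_sq_snd_of_represents h1, enorm_sq_eq_lintegral]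
  have e : ∫⁻ p, ‖q.1.fst p‖ₑ ^ 2 ∂(wMeasure Ω Y s) = ∫⁻ p, ‖φ p‖ₑ ^ 2 ∂(wMeasure Ω Y s) :=
    lintegral_congr_ae (h1.1.mono fun p hp => by simp only [hp])
  have hc : Continuous φ := hφ.1.continuous
  rw [e, lintegral_wMeasure_symm s (f := fun p => ‖φ p‖ₑ ^ 2) (by fun_prop), mul_assoc,
    ← lintegral_mul_const _ (by fun_prop)]
  exact setLIntegral_mono' measurableSet_Ioo fun t ht => by
    gcongr
    exact lintegral_slice_le hφ hs0 (Ioo_subset_Icc_self ht)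

theorem le_of_mem_closure_testPairs {C : ℝ}
    {f g : Pairs Ω Y s × L2 Ω → ℝ} (hf : Continuous f) (hg : Continuous g)
    (h : ∀ q ∈ testPairs Ω Y s, f q ≤ C * g q) :
    ∀ q ∈ (testPairs Ω Y s).topologicalClosure, f q ≤ C * g q := fun _ hq =>
  closure_minimal (s := (testPairs Ω Y s : Set (Pairs Ω Y s × L2 Ω))) (fun q hq => h q hq) 
    (isClosed_le hf (continuous_const.mul hg)) hq

theorem exists_bounds (Ω : Set (EuclideanSpace ℝ (Fin n))) (hY : 0 < Y) (hs0 : 0 < s)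
    (hs1 : s < 1) :
    ∃ C : ℝ, 0 ≤ C ∧ ∀ q ∈ (testPairs Ω Y s).topologicalClosure,
      ‖q.2‖ ^ 2 ≤ C * ‖q.1.snd‖ ^ 2 ∧ ‖q.1.fst‖ ^ 2 ≤ C * ‖q.1.snd‖ ^ 2 := by
  obtain ⟨C₁, h0, h1⟩ := exists_trace_bound Ω hY hs0
  obtain ⟨C₂, h0', h2⟩ := exists_poincare_bound Ω Y hs0 hs1
  have hsnd : Continuous fun q : Pairs Ω Y s × L2 Ω => ‖q.1.snd‖ ^ 2 := by fun_prop
  refine ⟨max C₁ C₂, h0.trans (le_max_left _ _), fun q hq => ⟨?_, ?_⟩⟩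
  · refine (le_of_mem_closure_testPairs (f := fun q => ‖q.2‖ ^ 2) (by fun_prop) hsnd h1 q hq).trans
      ?_
    gcongr
    exact le_max_left _ _
  · refine (le_of_mem_closure_testPairs (f := fun q => ‖q.1.fst‖ ^ 2) (by fun_prop) hsnd h2 q
      hq).trans ?_
    gcongr
    exact le_max_right _ _

/-- If the second component is controlled by the first on a subspace `G`, then limits of first
components are first components of limits. -/
theorem exists_mem_topologicalClosure_of_bound {E F : Type*} [NormedAddCommGroup E]
    [NormedSpace ℝ E] [CompleteSpace E] [NormedAddCommGroup F] [NormedSpace ℝ F] [CompleteSpace F]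
    {G : Submodule ℝ (E × F)} {C : ℝ} (hC : ∀ q ∈ G.topologicalClosure, ‖q.2‖ ≤ C * ‖q.1‖) {u : E}
    (hu : u ∈ closure {v | ∃ z, (v, z) ∈ G}) : ∃ z, (u, z) ∈ G.topologicalClosure := by
  let P : G.topologicalClosure →L[ℝ] E :=
    ContinuousLinearMap.fst ℝ E F ∘L G.topologicalClosure.subtypeL
  -- The product carries the sup norm, so a point of the closure has norm at most `max 1 C` times
  -- that of its first component. The projection is therefore bounded below and has closed range.
  have hP : AntilipschitzWith (Real.toNNReal (max 1 C)) P := by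
    refine P.antilipschitz_of_bound fun q => ?_
    rw [Real.coe_toNNReal _ (le_max_of_le_left zero_le_one)]
    refine max_le (le_mul_of_one_le_left (norm_nonneg _) (le_max_left _ _))
      ((hC q q.2).trans ?_)
    exact mul_le_mul_of_nonneg_right (le_max_right _ _) (norm_nonneg _)
  have hcl : IsClosed (range P) := hP.isClosed_range P.uniformContinuous
  have hsub : {v | ∃ z, (v, z) ∈ G} ⊆ range P :=
    fun v ⟨z, hz⟩ => ⟨⟨(v, z), subset_closure hz⟩, rfl⟩
  obtain ⟨q, rfl⟩ := closure_minimal hsub hcl hu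
  exact ⟨q.1.2, q.2⟩

/-- Recasts traces as membership in a closed subspace, so that they can be added, scaled and
subtracted. -/
theorem isTrace_iff {u : Pairs Ω Y s} {z : L2 Ω} :
    IsTrace u z ↔ (u, z) ∈ (testPairs Ω Y s).topologicalClosure := Iff.rfl

theorem exists_mem_testPairs (hΩb : Bornology.IsBounded Ω) {u : Pairs Ω Y s}
    {φ : EuclideanSpace ℝ (Fin n) × ℝ → ℝ} (hφ : φ ∈ testFunctions (Ω ×ˢ Iio Y))
    (h : Represents φ u) : ∃ z, (u, z) ∈ testPairs Ω Y s := by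
  have : IsFiniteMeasure (volume.restrict Ω) := ⟨by simpa using hΩb.measure_lt_top⟩
  have hc : Continuous fun x : EuclideanSpace ℝ (Fin n) => φ (x, 0) :=
    hφ.1.continuous.comp (by fun_prop)
  have hm : MemLp (fun x => φ (x, 0)) 2 (volume.restrict Ω) := by
    obtain ⟨C, hC⟩ := hφ.2.1.exists_bound_of_continuous hφ.1.continuous
    exact MemLp.of_bound hc.aestronglyMeasurable C (.of_forall fun x => hC _)
  exact ⟨hm.toLp, φ, hφ, h, hm.coeFn_toLp⟩

/-- Limits of test functions have a trace. -/
theorem exists_isTrace (hΩb : Bornology.IsBounded Ω) (hY : 0 < Y) (hs0 : 0 < s) (hs1 : s < 1)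
    {u : Pairs Ω Y s}
    (hu : u ∈ closure {v | ∃ φ ∈ testFunctions (Ω ×ˢ Iio Y), Represents φ v}) :
    ∃ z, IsTrace u z := by
  obtain ⟨C, hC0, hC⟩ := exists_bounds Ω hY hs0 hs1
  refine exists_mem_topologicalClosure_of_bound (G := testPairs Ω Y s) (C := Real.sqrt C)
    (fun q hq => ?_) (closure_mono ?_ hu)
  · refine le_of_sq_le_sq ?_ (by positivity)
    rw [mul_pow, Real.sq_sqrt hC0]
    refine (hC q hq).1.trans ?_
    gcongr
    exact WithLp.norm_snd_le _ _
  · rintro v ⟨φ, hφ, hv⟩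
    exact exists_mem_testPairs hΩb hφ hv

/-- The difference `(0, z - z')` lies in the closed subspace and has zero gradient, so the trace
bound kills it. This makes the choice in `tr` canonical. -/
theorem IsTrace.unique (hY : 0 < Y) (hs0 : 0 < s) (hs1 : s < 1) {u : Pairs Ω Y s} {z z' : L2 Ω}
    (h : IsTrace u z) (h' : IsTrace u z') : z = z' := by
  obtain ⟨C, hC0, hC⟩ := exists_bounds Ω hY hs0 hs1
  have := (hC _ (Submodule.sub_mem _ (isTrace_iff.1 h) (isTrace_iff.1 h'))).1
  simpa [sub_eq_zero] using this

end Trace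

/-! ### `H1` and `HL` as closed subspaces -/

section SobolevSpace

variable {n : ℕ} {Ω : Set (EuclideanSpace ℝ (Fin n))} {Y s : ℝ}

theorem isOpen_cyl (hΩ : IsOpen Ω) (Y : ℝ) : IsOpen (cyl Ω Y) := hΩ.prod isOpen_Ioo

theorem integral_wMeasure {G : Type*} [NormedAddCommGroup G] [NormedSpace ℝ G]
    (f : EuclideanSpace ℝ (Fin n) × ℝ → G) :
    ∫ p, f p ∂(wMeasure Ω Y s) =
      ∫ p in cyl Ω Y, (ENNReal.ofReal (p.2 ^ (1 - 2 * s))).toReal • f p :=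
  integral_withDensity_eq_integral_toReal_smul (measurable_weight s)
    (.of_forall fun _ => ENNReal.ofReal_lt_top) f

/-- Integration against a continuous field with compact support in the cylinder is continuous
on the weighted space. -/
theorem exists_pairing (hΩ : IsOpen Ω) (hΩb : Bornology.IsBounded Ω) (hs1 : s < 1)
    {E F G : Type*} [NormedAddCommGroup E]
    [NormedSpace ℝ E] [NormedAddCommGroup F] [NormedSpace ℝ F] [NormedAddCommGroup G]
    [NormedSpace ℝ G] [CompleteSpace G] (B : E →L[ℝ] F →L[ℝ] G)
    {h : EuclideanSpace ℝ (Fin n) × ℝ → F} (hc : Continuous h) (hcs : HasCompactSupport h)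
    (hsupp : tsupport h ⊆ cyl Ω Y) :
    ∃ ℓ : Lp E 2 (wMeasure Ω Y s) →L[ℝ] G, ∀ w, ℓ w = ∫ p in cyl Ω Y, B (w p) (h p) := by
  have := isFiniteMeasure_wMeasure (Y := Y) hΩb hs1
  -- Dividing by the weight turns the unweighted integral into a weighted pairing. The compact
  -- support inside the cylinder keeps `y` away from `0`, so `k` is bounded.
  let k : EuclideanSpace ℝ (Fin n) × ℝ → F := fun p => p.2 ^ (-(1 - 2 * s)) • h p
  have hkc : ContinuousOn k (tsupport h) := by
    refine ContinuousOn.smul (fun p hp => ?_) hc.continuousOn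
    exact (continuousAt_snd.rpow_const (Or.inl (hsupp hp).2.1.ne')).continuousWithinAt
  obtain ⟨C, hC⟩ := IsCompact.exists_bound_of_continuousOn hcs hkc
  have hk : MemLp k 2 (wMeasure Ω Y s) := by
    refine MemLp.of_bound (C := max C 0) ?_ (.of_forall fun p => ?_)
    · exact AEStronglyMeasurable.smul (f := fun p : EuclideanSpace ℝ (Fin n) × ℝ =>
        p.2 ^ (-(1 - 2 * s))) (measurable_snd.pow_const _).aestronglyMeasurable
        (hc.stronglyMeasurable_of_hasCompactSupport hcs).aestronglyMeasurable
    · by_cases hp : p ∈ tsupport h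
      · exact (hC p hp).trans (le_max_left _ _)
      · simp [k, image_eq_zero_of_notMem_tsupport hp]
  refine ⟨(B.lpPairing (wMeasure Ω Y s) 2 2).flip hk.toLp, fun w => ?_⟩
  rw [ContinuousLinearMap.flip_apply, ContinuousLinearMap.lpPairing_eq_integral]
  have e : ∫ p, B (w p) (hk.toLp k p) ∂(wMeasure Ω Y s) = ∫ p, B (w p) (k p) ∂(wMeasure Ω Y s) :=
    integral_congr_ae (hk.coeFn_toLp.mono fun p hp => by simp only [hp])
  rw [e, integral_wMeasure]
  refine setIntegral_congr_fun (isOpen_cyl hΩ Y).measurableSet fun p hp => ?_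
  have hp2 : 0 < p.2 := hp.2.1
  simp only [k, map_smul, smul_smul]
  rw [ENNReal.toReal_ofReal (Real.rpow_nonneg hp2.le _), ← Real.rpow_add hp2]
  simp

/-- Each test function gives a continuous linear condition for weak differentiability. -/
theorem exists_weakGrad_functional (hΩ : IsOpen Ω) (hΩb : Bornology.IsBounded Ω) (hs1 : s < 1)
    {ψ : EuclideanSpace ℝ (Fin n) × ℝ → ℝ} (hψ : ψ ∈ testFunctions (cyl Ω Y)) :
    ∃ ℓ : Pairs Ω Y s →L[ℝ] Vec n, ∀ u, ℓ u = 0 ↔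
      ∫ p in cyl Ω Y, u.fst p • grad ψ p = - ∫ p in cyl Ω Y, ψ p • u.snd p := by
  obtain ⟨ℓ₁, h₁⟩ := exists_pairing hΩ hΩb hs1 (ContinuousLinearMap.lsmul ℝ ℝ (E := Vec n))
    (continuous_grad hψ.1) (hasCompactSupport_grad hψ.2.1)
    ((tsupport_grad_subset ψ).trans hψ.2.2)
  obtain ⟨ℓ₂, h₂⟩ := exists_pairing hΩ hΩb hs1 (ContinuousLinearMap.lsmul ℝ ℝ (E := Vec n)).flip
    hψ.1.continuous hψ.2.1 hψ.2.2
  refine ⟨ℓ₁ ∘L WithLp.fstL 2 ℝ _ _ + ℓ₂ ∘L WithLp.sndL 2 ℝ _ _, fun u => ?_⟩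
  rw [← add_eq_zero_iff_eq_neg]
  have e₁ := h₁ u.fst
  have e₂ := h₂ u.snd
  simp only [ContinuousLinearMap.lsmul_apply, ContinuousLinearMap.flip_apply] at e₁ e₂
  rw [← e₁, ← e₂]
  rfl

/-- The weighted Sobolev space is a closed subspace. -/
theorem exists_submodule_H1 (hΩ : IsOpen Ω) (hΩb : Bornology.IsBounded Ω) (hs1 : s < 1) :
    ∃ W : Submodule ℝ (Pairs Ω Y s), (W : Set (Pairs Ω Y s)) = H1 Ω Y s ∧
      IsClosed (W : Set (Pairs Ω Y s)) := by
  choose ℓ hℓ using fun ψ : testFunctions (cyl Ω Y) =>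
    exists_weakGrad_functional (s := s) hΩ hΩb hs1 ψ.2
  refine ⟨⨅ ψ, (ℓ ψ).ker, ?_, ?_⟩
  · ext u
    simp [H1, IsWeakGrad, hℓ]
  · rw [Submodule.coe_iInf]
    exact isClosed_iInter fun ψ => (ℓ ψ).isClosed_ker

theorem IsTrace.mem_closure {u : Pairs Ω Y s} {z : L2 Ω} (h : IsTrace u z) :
    u ∈ closure {v | ∃ φ ∈ testFunctions (Ω ×ˢ Iio Y), Represents φ v} :=
  map_mem_closure continuous_fst h fun _ ⟨φ, hφ, hq⟩ => ⟨φ, hφ, hq.1⟩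

theorem isTrace_tr (hΩb : Bornology.IsBounded Ω) (hY : 0 < Y) (hs0 : 0 < s) (hs1 : s < 1)
    {u : Pairs Ω Y s} (hu : u ∈ HL Ω Y s) : IsTrace u (tr u) :=
  Classical.epsilon_spec (exists_isTrace hΩb hY hs0 hs1 hu.2)

/-- `HL` is a closed subspace. -/
theorem exists_submodule_HL (hΩ : IsOpen Ω) (hΩb : Bornology.IsBounded Ω) (hY : 0 < Y)
    (hs0 : 0 < s) (hs1 : s < 1) :
    ∃ V : Submodule ℝ (Pairs Ω Y s), (V : Set (Pairs Ω Y s)) = HL Ω Y s ∧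
      IsClosed (V : Set (Pairs Ω Y s)) := by
  obtain ⟨W, hW, hWc⟩ := exists_submodule_H1 (Y := Y) hΩ hΩb hs1
  -- Linearity comes from projecting the closed space of pairs to its first factor; closedness is
  -- read off the definition of `HL`.
  have e : ((W ⊓ (testPairs Ω Y s).topologicalClosure.map (LinearMap.fst ℝ _ _) :
      Submodule ℝ (Pairs Ω Y s)) : Set (Pairs Ω Y s)) = HL Ω Y s := by
    ext u
    rw [Submodule.coe_inf, hW]
    refine and_congr_right fun _ => ⟨?_, fun hu => ?_⟩
    · rintro ⟨⟨v, z⟩, hv, rfl⟩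
      exact IsTrace.mem_closure (z := z) hv
    · obtain ⟨z, hz⟩ := exists_isTrace hΩb hY hs0 hs1 hu
      exact ⟨(u, z), hz, rfl⟩
  refine ⟨_, e, ?_⟩
  rw [e]
  exact (hW ▸ hWc).inter isClosed_closure

/-- The trace is a continuous linear map on `HL`. -/
theorem exists_traceCLM (hΩb : Bornology.IsBounded Ω) (hY : 0 < Y)
    (hs0 : 0 < s) (hs1 : s < 1) {V : Submodule ℝ (Pairs Ω Y s)}
    (hV : (V : Set (Pairs Ω Y s)) = HL Ω Y s) :
    ∃ T : V →L[ℝ] L2 Ω, ∀ u : V, T u = tr (u : Pairs Ω Y s) := by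
  have htr : ∀ u : V, IsTrace (u : Pairs Ω Y s) (tr (u : Pairs Ω Y s)) := fun u =>
    isTrace_tr hΩb hY hs0 hs1 (hV ▸ u.2)
  obtain ⟨C, hC0, hC⟩ := exists_bounds Ω hY hs0 hs1
  -- Sums and multiples of traces are again traces of the combined function, so uniqueness forces
  -- linearity.
  let T : V →ₗ[ℝ] L2 Ω :=
    { toFun := fun u => tr (u : Pairs Ω Y s)
      map_add' := fun u v => (htr (u + v)).unique hY hs0 hs1 (Submodule.add_mem
        (testPairs Ω Y s).topologicalClosure (isTrace_iff.1 (htr u)) (isTrace_iff.1 (htr v)))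
      map_smul' := fun t u => (htr (t • u)).unique hY hs0 hs1 (Submodule.smul_mem
        (testPairs Ω Y s).topologicalClosure t (isTrace_iff.1 (htr u))) }
  refine ⟨T.mkContinuous (Real.sqrt C) fun u => ?_, fun u => rfl⟩
  refine le_of_sq_le_sq ?_ (by positivity)
  rw [mul_pow, Real.sq_sqrt hC0]
  refine (hC _ (isTrace_iff.1 (htr u))).1.trans ?_
  gcongr
  exact WithLp.norm_snd_le _ _

/-- On `HL` the gradient controls the full norm. -/
theorem exists_norm_le_gradient (hΩb : Bornology.IsBounded Ω) (hY : 0 < Y)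
    (hs0 : 0 < s) (hs1 : s < 1) :
    ∃ C : ℝ, 0 < C ∧ ∀ u ∈ HL Ω Y s, ‖u‖ ^ 2 ≤ C * ‖u.snd‖ ^ 2 := by
  obtain ⟨C, hC0, hC⟩ := exists_bounds Ω hY hs0 hs1
  refine ⟨C + 1, by positivity, fun u hu => ?_⟩
  rw [WithLp.prod_norm_sq_eq_of_L2]
  linarith [(hC _ (isTrace_iff.1 (isTrace_tr hΩb hY hs0 hs1 hu))).2]

end SobolevSpace

/-! ### The bilinear form: boundedness, symmetry, ellipticity -/

section Form

variable {n : ℕ} {Ω : Set (EuclideanSpace ℝ (Fin n))} {Y s : ℝ}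

theorem wMeasure_absolutelyContinuous (Ω : Set (EuclideanSpace ℝ (Fin n))) (Y s : ℝ) :
    wMeasure Ω Y s ≪ (volume.restrict Ω).prod (volume.restrict (Ioo 0 Y)) := by
  rw [wMeasure_eq_prod]
  exact withDensity_absolutelyContinuous _ _

/-- Null sets of `Ω` lift to null sets of the cylinder, which transfers hypotheses on the
coefficients. -/
theorem ae_wMeasure_of_ae {P : EuclideanSpace ℝ (Fin n) → Prop}
    (h : ∀ᵐ x ∂(volume.restrict Ω), P x) : ∀ᵐ p ∂(wMeasure Ω Y s), P p.1 :=
  (wMeasure_absolutelyContinuous Ω Y s).ae_le (Measure.quasiMeasurePreserving_fst.ae h)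

theorem dConst_pos (hs0 : 0 < s) (hs1 : s < 1) : 0 < dConst s := by
  have h1 := Real.Gamma_pos_of_pos hs0
  have h2 := Real.Gamma_pos_of_pos (sub_pos.2 hs1)
  unfold dConst
  positivity

/-- `extMul M` as a continuous linear map. -/
noncomputable def extMulCLM (M : Matrix (Fin n) (Fin n) ℝ) : Vec n →L[ℝ] Vec n :=
  (WithLp.prodContinuousLinearEquiv 2 ℝ (EuclideanSpace ℝ (Fin n)) ℝ).symm.toContinuousLinearMap ∘L
    ((Matrix.toEuclideanLin M).toContinuousLinearMap ∘L WithLp.fstL 2 ℝ _ _).prod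
      (WithLp.sndL 2 ℝ _ _)

theorem extMulCLM_apply (M : Matrix (Fin n) (Fin n) ℝ) (ξ : Vec n) :
    extMulCLM M ξ = extMul M ξ := rfl

theorem continuous_extMulCLM : Continuous (extMulCLM (n := n)) := by
  refine continuous_clm_apply.2 fun ξ => ?_
  have h : Continuous fun M : Matrix (Fin n) (Fin n) ℝ => Matrix.toEuclideanLin M ξ.fst :=
    LinearMap.continuous_of_finiteDimensional
      ((LinearMap.applyₗ ξ.fst).comp (Matrix.toEuclideanLin (𝕜 := ℝ) (m := Fin n)
        (n := Fin n)).toLinearMap)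
  simp only [extMulCLM_apply, extMul]
  fun_prop

theorem inner_extMul_comm {M : Matrix (Fin n) (Fin n) ℝ} (hM : M.IsSymm) (ξ η : Vec n) :
    inner ℝ (extMul M ξ) η = inner ℝ (extMul M η) ξ := by
  have h := Matrix.isSymmetric_toEuclideanLin_iff.2
    (show M.IsHermitian by simpa [Matrix.IsHermitian, Matrix.IsSymm] using hM) ξ.fst η.fst
  change inner ℝ (Matrix.toEuclideanLin M ξ.fst) η.fst + inner ℝ ξ.snd η.snd =
    inner ℝ (Matrix.toEuclideanLin M η.fst) ξ.fst + inner ℝ η.snd ξ.snd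
  rw [h, real_inner_comm, real_inner_comm ξ.snd]

/-- The block `M` contributes the constant `l` and the last diagonal entry contributes `1`; hence
the minimum. -/
theorem le_inner_extMul {M : Matrix (Fin n) (Fin n) ℝ} {l : ℝ}
    (hM : ∀ ξ : Fin n → ℝ, l * (ξ ⬝ᵥ ξ) ≤ ξ ⬝ᵥ M.mulVec ξ) (ξ : Vec n) :
    min l 1 * ‖ξ‖ ^ 2 ≤ inner ℝ (extMul M ξ) ξ := by
  have e1 : inner ℝ (Matrix.toEuclideanLin M ξ.fst) ξ.fst =
      ξ.fst.ofLp ⬝ᵥ M.mulVec ξ.fst.ofLp := by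
    simp [EuclideanSpace.inner_eq_star_dotProduct]
  have e2 : ‖ξ.fst‖ ^ 2 = ξ.fst.ofLp ⬝ᵥ ξ.fst.ofLp := by
    rw [← real_inner_self_eq_norm_sq, EuclideanSpace.inner_eq_star_dotProduct]
    simp
  have h := hM ξ.fst.ofLp
  rw [← e1, ← e2] at h
  have e3 : inner ℝ (extMul M ξ) ξ =
      inner ℝ (Matrix.toEuclideanLin M ξ.fst) ξ.fst + ‖ξ.snd‖ ^ 2 := by
    rw [← real_inner_self_eq_norm_sq]
    rfl
  rw [e3, WithLp.prod_norm_sq_eq_of_L2]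
  nlinarith [min_le_left l 1, min_le_right l 1, sq_nonneg ‖ξ.fst‖, sq_nonneg ‖ξ.snd‖]

theorem continuousOn_coefficient {A : EuclideanSpace ℝ (Fin n) → Matrix (Fin n) (Fin n) ℝ}
    (hALip : ∀ i j, ∃ K, LipschitzOnWith K (fun x => A x i j) Ω) : ContinuousOn A Ω :=
  continuousOn_pi.2 fun i => continuousOn_pi.2 fun j => (hALip i j).choose_spec.continuousOn

theorem exists_bound_extMulCLM (hΩb : Bornology.IsBounded Ω)
    {A : EuclideanSpace ℝ (Fin n) → Matrix (Fin n) (Fin n) ℝ}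
    (hALip : ∀ i j, ∃ K, LipschitzOnWith K (fun x => A x i j) Ω) :
    ∃ C : ℝ, ∀ x ∈ Ω, ‖extMulCLM (A x)‖ ≤ C := by
  have hb : ∀ i j, ∃ R : ℝ, ∀ x ∈ Ω, A x i j ∈ Metric.closedBall (0 : ℝ) R := fun i j => by
    obtain ⟨K, hK⟩ := hALip i j
    obtain ⟨g, hg, hgA⟩ := hK.extend_real
    obtain ⟨R, hR⟩ := (hg.isBounded_image hΩb).subset_closedBall 0
    exact ⟨R, fun x hx => hR ⟨x, hx, (hgA hx).symm⟩⟩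
  choose R hR using hb
  -- The values of `A` on `Ω` lie in a compact box of matrices, on which the continuous map
  -- `extMulCLM` is bounded.
  have hcomp : IsCompact (univ.pi fun i => univ.pi fun j => Metric.closedBall (0 : ℝ) (R i j)) :=
    isCompact_univ_pi fun i => isCompact_univ_pi fun j => isCompact_closedBall _ _
  obtain ⟨C, hC⟩ := hcomp.exists_bound_of_continuousOn (f := extMulCLM (n := n))
    continuous_extMulCLM.continuousOn
  exact ⟨C, fun x hx => hC _ fun i _ j _ => hR i j x hx⟩

theorem memLp_extMulCLM (hΩ : IsOpen Ω) (hΩb : Bornology.IsBounded Ω)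
    {A : EuclideanSpace ℝ (Fin n) → Matrix (Fin n) (Fin n) ℝ}
    (hALip : ∀ i j, ∃ K, LipschitzOnWith K (fun x => A x i j) Ω) :
    MemLp (fun p => extMulCLM (A p.1)) ⊤ (wMeasure Ω Y s) := by
  obtain ⟨C, hC⟩ := exists_bound_extMulCLM hΩb hALip
  have hm : AEStronglyMeasurable (fun x => extMulCLM (A x)) (volume.restrict Ω) :=
    (continuous_extMulCLM.comp_continuousOn (continuousOn_coefficient hALip)).aestronglyMeasurable
      hΩ.measurableSet
  exact memLp_top_of_bound (hm.comp_fst.mono_ac (wMeasure_absolutelyContinuous Ω Y s)) C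
    (ae_wMeasure_of_ae (ae_restrict_of_forall_mem hΩ.measurableSet hC))

theorem memLp_potential {c : EuclideanSpace ℝ (Fin n) → ℝ}
    (hc : MemLp c ⊤ (volume.restrict Ω)) : MemLp (fun p => c p.1) ⊤ (wMeasure Ω Y s) := by
  have h := hc.comp_fst (volume.restrict (Ioo 0 Y))
  have hac := wMeasure_absolutelyContinuous Ω Y s
  refine ⟨h.1.mono_ac hac, ?_⟩
  have h2 := h.2
  rw [eLpNorm_exponent_top] at h2 ⊢
  exact (eLpNormEssSup_mono_measure _ hac).trans_lt h2

variable {A : EuclideanSpace ℝ (Fin n) → Matrix (Fin n) (Fin n) ℝ}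
  {c : EuclideanSpace ℝ (Fin n) → ℝ}

/-- The form is a bounded bilinear form, and its integrand is integrable. -/
theorem exists_formCLM (hΩ : IsOpen Ω) (hΩb : Bornology.IsBounded Ω)
    (hALip : ∀ i j, ∃ K, LipschitzOnWith K (fun x => A x i j) Ω)
    (hc : MemLp c ⊤ (volume.restrict Ω)) :
    ∃ B : Pairs Ω Y s →L[ℝ] Pairs Ω Y s →L[ℝ] ℝ, (∀ w φ, B w φ = form A c w φ) ∧
      ∀ w φ : Pairs Ω Y s, Integrable (fun p => inner ℝ (extMul (A p.1) (w.snd p)) (φ.snd p)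
        + c p.1 * w.fst p * φ.fst p) (wMeasure Ω Y s) := by
  have hA := memLp_extMulCLM (Y := Y) (s := s) hΩ hΩb hALip
  have hc' := memLp_potential (Y := Y) (s := s) hc
  -- Multiplication by an `L^∞` coefficient is a bounded operator on `L²`, so the form becomes a sum
  -- of two `L²` inner products.
  let MA : Lp (Vec n) 2 (wMeasure Ω Y s) →L[ℝ] Lp (Vec n) 2 (wMeasure Ω Y s) :=
    (ContinuousLinearMap.id ℝ (Vec n →L[ℝ] Vec n)).holderL (wMeasure Ω Y s) ⊤ 2 2 hA.toLp
  let MC : Lp ℝ 2 (wMeasure Ω Y s) →L[ℝ] Lp ℝ 2 (wMeasure Ω Y s) :=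
    (ContinuousLinearMap.mul ℝ ℝ).holderL (wMeasure Ω Y s) ⊤ 2 2 hc'.toLp
  have eA : ∀ g, MA g =ᵐ[wMeasure Ω Y s] fun p => extMul (A p.1) (g p) := fun g => by
    filter_upwards [(ContinuousLinearMap.id ℝ (Vec n →L[ℝ] Vec n)).coeFn_holder (r := 2)
      hA.toLp g, hA.coeFn_toLp] with p h1 h2
    exact h1.trans (by rw [h2]; rfl)
  have eC : ∀ w, MC w =ᵐ[wMeasure Ω Y s] fun p => c p.1 * w p := fun w => by
    filter_upwards [(ContinuousLinearMap.mul ℝ ℝ).coeFn_holder (r := 2) hc'.toLp w,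
      hc'.coeFn_toLp] with p h1 h2
    exact h1.trans (by rw [h2]; rfl)
  have hmul : ∀ x y : ℝ, inner ℝ x y = x * y := fun x y => by simp [mul_comm]
  have e : ∀ w φ : Pairs Ω Y s, (fun p => inner ℝ (MA w.snd p) (φ.snd p)
      + inner ℝ (MC w.fst p) (φ.fst p)) =ᵐ[wMeasure Ω Y s]
      fun p => inner ℝ (extMul (A p.1) (w.snd p)) (φ.snd p) + c p.1 * w.fst p * φ.fst p :=
    fun w φ => by
      filter_upwards [eA w.snd, eC w.fst] with p h1 h2
      rw [h1, h2, hmul]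
  obtain ⟨B₁, h₁⟩ := exists_bilin_inner MA
    (WithLp.sndL 2 ℝ (Lp ℝ 2 (wMeasure Ω Y s)) (Lp (Vec n) 2 (wMeasure Ω Y s)))
  obtain ⟨B₂, h₂⟩ := exists_bilin_inner MC
    (WithLp.fstL 2 ℝ (Lp ℝ 2 (wMeasure Ω Y s)) (Lp (Vec n) 2 (wMeasure Ω Y s)))
  refine ⟨(1 / dConst s) • (B₁ + B₂), fun w φ => ?_, fun w φ => ?_⟩
  · rw [form, ← integral_congr_ae (e w φ), integral_add (L2.integrable_inner _ _)
      (L2.integrable_inner _ _), ← L2.inner_def, ← L2.inner_def]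
    exact congrArg₂ (fun x y => 1 / dConst s * (x + y)) (h₁ w φ) (h₂ w φ)
  · exact (integrable_congr (e w φ)).1 ((L2.integrable_inner _ _).add (L2.integrable_inner _ _))

theorem form_comm (hΩ : IsOpen Ω) (hAsymm : ∀ x ∈ Ω, (A x).IsSymm) (w φ : Pairs Ω Y s) :
    form A c w φ = form A c φ w := by
  unfold form
  congr 1
  refine integral_congr_ae ?_
  filter_upwards [ae_wMeasure_of_ae (ae_restrict_of_forall_mem hΩ.measurableSet hAsymm)] with p hp
  rw [inner_extMul_comm hp]
  ring

/-- Integrate the pointwise ellipticity and drop the term `c w²`, which is nonnegative almost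
everywhere. -/
theorem le_form_self (hΩ : IsOpen Ω) (hΩb : Bornology.IsBounded Ω) (hs0 : 0 < s) (hs1 : s < 1)
    (hALip : ∀ i j, ∃ K, LipschitzOnWith K (fun x => A x i j) Ω)
    {l : ℝ} (hAell : ∀ x ∈ Ω, ∀ ξ : Fin n → ℝ, l * (ξ ⬝ᵥ ξ) ≤ ξ ⬝ᵥ (A x).mulVec ξ)
    (hc : MemLp c ⊤ (volume.restrict Ω)) (hc0 : ∀ᵐ x ∂(volume.restrict Ω), 0 ≤ c x)
    (w : Pairs Ω Y s) :
    1 / dConst s * min l 1 * ‖w.snd‖ ^ 2 ≤ form A c w w := by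
  obtain ⟨-, -, hint⟩ := exists_formCLM (Y := Y) (s := s) hΩ hΩb hALip hc
  have hd := dConst_pos hs0 hs1
  rw [form, mul_assoc]
  refine mul_le_mul_of_nonneg_left ?_ (by positivity)
  rw [← real_inner_self_eq_norm_sq, L2.inner_def, ← integral_const_mul]
  refine integral_mono_ae ((L2.integrable_inner _ _).const_mul _) (hint w w) ?_
  filter_upwards [ae_wMeasure_of_ae hc0,
    ae_wMeasure_of_ae (ae_restrict_of_forall_mem hΩ.measurableSet hAell)] with p h1 h2
  rw [real_inner_self_eq_norm_sq, mul_assoc]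
  exact le_add_of_le_of_nonneg (le_inner_extMul h2 _) (mul_nonneg h1 (mul_self_nonneg _))

end Form

/-! ### Admissible controls and the control-to-state operator -/

section Control

variable {n : ℕ} {Ω : Set (EuclideanSpace ℝ (Fin n))} {Y s : ℝ}

theorem Zad_eq_Icc (a b : L2 Ω) : Zad a b = Icc a b := by
  ext r
  rw [mem_Icc, ← Lp.coeFn_le, ← Lp.coeFn_le]
  exact Filter.eventually_and (f := ae (volume.restrict Ω))

theorem isClosed_Zad (a b : L2 Ω) : IsClosed (Zad a b) := by
  rw [Zad_eq_Icc]
  exact isClosed_Icc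

theorem nonempty_Zad {a b : L2 Ω} (hab : ∀ᵐ x ∂(volume.restrict Ω), a x ≤ b x) :
    (Zad a b).Nonempty :=
  ⟨a, hab.mono fun _ hx => ⟨le_rfl, hx⟩⟩

theorem convex_Zad (a b : L2 Ω) : Convex ℝ (Zad a b) := by
  intro r hr q hq t t' ht ht' htt'
  filter_upwards [hr, hq, Lp.coeFn_add (t • r) (t' • q), Lp.coeFn_smul t r, Lp.coeFn_smul t' q]
    with x h1 h2 h3 h4 h5
  rw [h3, Pi.add_apply, h4, h5]
  exact convex_Icc (a x) (b x) h1 h2 ht ht' htt'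

variable {A : EuclideanSpace ℝ (Fin n) → Matrix (Fin n) (Fin n) ℝ}
  {c : EuclideanSpace ℝ (Fin n) → ℝ}

/-- The state equation has a unique solution, and the map from the datum to the trace of the
solution is a self-adjoint bounded operator. -/
theorem exists_controlToState (hΩ : IsOpen Ω) (hΩb : Bornology.IsBounded Ω) (hY : 0 < Y)
    (hs0 : 0 < s) (hs1 : s < 1)
    (hALip : ∀ i j, ∃ K, LipschitzOnWith K (fun x => A x i j) Ω)
    (hAsymm : ∀ x ∈ Ω, (A x).IsSymm)
    (hAell : ∃ l : ℝ, 0 < l ∧ ∀ x ∈ Ω, ∀ ξ : Fin n → ℝ, l * (ξ ⬝ᵥ ξ) ≤ ξ ⬝ᵥ (A x).mulVec ξ)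
    (hc : MemLp c ⊤ (volume.restrict Ω)) (hc0 : ∀ᵐ x ∂(volume.restrict Ω), 0 ≤ c x) :
    ∃ (S : L2 Ω → Pairs Ω Y s) (T : L2 Ω →L[ℝ] L2 Ω), (∀ f v, Solves A c f v ↔ v = S f) ∧
      (∀ f, tr (S f) = T f) ∧ ∀ f g, inner ℝ (T f) g = inner ℝ f (T g) := by
  obtain ⟨V, hV, hVc⟩ := exists_submodule_HL (Y := Y) hΩ hΩb hY hs0 hs1
  obtain ⟨τ, hτ⟩ := exists_traceCLM hΩb hY hs0 hs1 hV
  obtain ⟨B, hB, -⟩ := exists_formCLM (Y := Y) (s := s) hΩ hΩb hALip hc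
  obtain ⟨l, hl, hAl⟩ := hAell
  obtain ⟨C, hC, hCu⟩ := exists_norm_le_gradient (Ω := Ω) hΩb hY hs0 hs1
  have hd := dConst_pos hs0 hs1
  have : CompleteSpace V := hVc.completeSpace_coe
  have hmem : ∀ u : V, (u : Pairs Ω Y s) ∈ HL Ω Y s := fun u => hV ▸ u.2
  let BV : V →L[ℝ] V →L[ℝ] ℝ := B.bilinearComp V.subtypeL V.subtypeL
  have hBV : ∀ u w : V, BV u w = form A c (u : Pairs Ω Y s) (w : Pairs Ω Y s) := fun u w => hB _ _
  have hcoer : IsCoercive BV := by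
    have hκ : 0 < 1 / dConst s * min l 1 := by positivity
    -- Ellipticity bounds the form below by the gradient only; dividing by the Poincaré constant `C`
    -- recovers the full norm.
    refine ⟨1 / dConst s * min l 1 / C, by positivity, fun u => ?_⟩
    rw [hBV, mul_assoc, ← sq, div_mul_eq_mul_div, div_le_iff₀ hC]
    calc 1 / dConst s * min l 1 * ‖u‖ ^ 2
        ≤ 1 / dConst s * min l 1 * (C * ‖(u : Pairs Ω Y s).snd‖ ^ 2) := by
          gcongr
          exact hCu _ (hmem u)
      _ = 1 / dConst s * min l 1 * ‖(u : Pairs Ω Y s).snd‖ ^ 2 * C := by ring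
      _ ≤ _ := by
          gcongr
          exact le_form_self hΩ hΩb hs0 hs1 hALip hAl hc hc0 _
  obtain ⟨S, hS⟩ := exists_solutionOperator hcoer τ
  have hSs : ∀ f (φ : V), BV (S f) φ = inner ℝ f (τ φ) := fun f => (hS f (S f)).2 rfl
  refine ⟨fun f => S f, τ ∘L S, fun f v => ⟨fun h => ?_, ?_⟩, fun f => (hτ _).symm,
    solutionOperator_selfAdjoint (fun u v => ?_) hSs⟩
  · have hv : v ∈ V := by
      rw [← SetLike.mem_coe, hV]
      exact h.1
    have := (hS f ⟨v, hv⟩).1 fun φ => by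
      rw [hBV, hτ]
      exact h.2 φ (hmem φ)
    exact congrArg Subtype.val this
  · rintro rfl
    refine ⟨hmem _, fun φ hφ => ?_⟩
    have hφV : φ ∈ V := by
      rw [← SetLike.mem_coe, hV]
      exact hφ
    have := hSs f ⟨φ, hφV⟩
    rwa [hBV, hτ] at this
  · rw [hBV, hBV, form_comm hΩ hAsymm]

end Control

end TruncControl

/-! ### Existence, uniqueness and the optimality system -/

theorem mainTheorem11 (n : ℕ) (hn : 1 ≤ n)
    (Ω : Set (EuclideanSpace ℝ (Fin n))) (hΩ : IsOpen Ω) (hΩb : Bornology.IsBounded Ω)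
    (Y : ℝ) (hY : 0 < Y) (s : ℝ) (hs0 : 0 < s) (hs1 : s < 1)
    (A : EuclideanSpace ℝ (Fin n) → Matrix (Fin n) (Fin n) ℝ)
    (hALip : ∀ i j, ∃ K, LipschitzOnWith K (fun x => A x i j) Ω)
    (hAsymm : ∀ x ∈ Ω, (A x).IsSymm)
    (hAell : ∃ l : ℝ, 0 < l ∧ ∀ x ∈ Ω, ∀ ξ : Fin n → ℝ, l * (ξ ⬝ᵥ ξ) ≤ ξ ⬝ᵥ (A x).mulVec ξ)
    (c : EuclideanSpace ℝ (Fin n) → ℝ) (hc : MemLp c ∞ (volume.restrict Ω))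
    (hc0 : ∀ᵐ x ∂(volume.restrict Ω), 0 ≤ c x)
    (a b : TruncControl.L2 Ω) (hab : ∀ᵐ x ∂(volume.restrict Ω), a x ≤ b x)
    (ud : TruncControl.L2 Ω) (mu : ℝ) (hmu : 0 < mu) :
    (∃! q : TruncControl.Pairs Ω Y s × TruncControl.L2 Ω,
      TruncControl.IsOptimal A c a b ud mu q.1 q.2) ∧
    (∀ (v : TruncControl.Pairs Ω Y s) (r : TruncControl.L2 Ω),
      TruncControl.IsOptimal A c a b ud mu v r →
        ∃! p : TruncControl.Pairs Ω Y s, TruncControl.OptimalitySystem A c a b ud mu v p r) ∧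
    (∀ (v p : TruncControl.Pairs Ω Y s) (r : TruncControl.L2 Ω),
      TruncControl.OptimalitySystem A c a b ud mu v p r →
        TruncControl.IsOptimal A c a b ud mu v r) := by
  obtain ⟨S, T, hS, hST, hT⟩ := TruncControl.exists_controlToState (Y := Y) hΩ hΩb hY hs0 hs1
    hALip hAsymm hAell hc hc0
  -- State and adjoint are determined by `r`, leaving one variational inequality.
  have hsys : ∀ v p r, TruncControl.OptimalitySystem A c a b ud mu v p r ↔
      (v = S r ∧ p = S (T r - ud)) ∧ r ∈ TruncControl.Zad a b ∧
        ∀ q ∈ TruncControl.Zad a b, 0 ≤ inner ℝ (T (T r - ud) + mu • r) (q - r) := by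
    intro v p r
    rw [TruncControl.OptimalitySystem, hS, hS, ← and_assoc]
    refine ⟨?_, ?_⟩
    · rintro ⟨⟨rfl, rfl⟩, h⟩
      rw [hST, hST] at h
      exact ⟨⟨rfl, by rw [hST]⟩, h⟩
    · rintro ⟨⟨rfl, rfl⟩, h⟩
      rw [hST, hST]
      exact ⟨⟨rfl, rfl⟩, h⟩
  have hopt : ∀ (v p : TruncControl.Pairs Ω Y s) r, TruncControl.OptimalitySystem A c a b ud mu v p r →
      TruncControl.IsOptimal A c a b ud mu v r := by
    intro v p r h
    obtain ⟨⟨rfl, -⟩, hr, hVI⟩ := (hsys v p r).1 h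
    refine ⟨hr, h.1, fun v' q hq hv' => ?_⟩
    rw [hS] at hv'
    subst hv'
    rw [hST, hST]
    have hg := TruncControl.reducedCost_growth hT ud mu (hVI q hq)
    unfold TruncControl.cost
    nlinarith [mul_nonneg hmu.le (sq_nonneg ‖q - r‖)]
  obtain ⟨r₀, hr₀, hVI₀⟩ := TruncControl.exists_variationalInequality hT ud hmu
    (TruncControl.isClosed_Zad a b) (TruncControl.convex_Zad a b) (TruncControl.nonempty_Zad hab)
  have hsys₀ : TruncControl.OptimalitySystem A c a b ud mu (S r₀) (S (T r₀ - ud)) r₀ :=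
    (hsys _ _ _).2 ⟨⟨rfl, rfl⟩, hr₀, hVI₀⟩
  -- An optimal `r` costs no more than `r₀`, while growth at `r₀` adds `mu / 2 * ‖r - r₀‖ ^ 2`;
  -- hence `r = r₀`.
  have huniq : ∀ (v : TruncControl.Pairs Ω Y s) r, TruncControl.IsOptimal A c a b ud mu v r → v = S r₀ ∧ r = r₀ := by
    rintro v r ⟨hr, hv, hmin⟩
    have hle := hmin _ _ hr₀ hsys₀.1
    rw [hS] at hv
    subst hv
    rw [hST, hST] at hle
    have hg := TruncControl.reducedCost_growth hT ud mu (hVI₀ r hr)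
    unfold TruncControl.cost at hle
    have h0 : mu / 2 * ‖r - r₀‖ ^ 2 ≤ 0 := by linarith
    have h1 : ‖r - r₀‖ ^ 2 ≤ 0 := nonpos_of_mul_nonpos_right h0 (by positivity)
    have h2 : r = r₀ := by
      simpa [sub_eq_zero] using le_antisymm h1 (sq_nonneg _)
    exact ⟨congrArg S h2, h2⟩
  refine ⟨⟨(S r₀, r₀), hopt _ _ _ hsys₀, ?_⟩, fun v r h => ?_, hopt⟩
  · rintro ⟨v, r⟩ h
    exact Prod.ext (huniq v r h).1 (huniq v r h).2
  -- The optimal pair is the one constructed from the variational inequality, so it already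
  -- satisfies the system.
  · obtain ⟨rfl, rfl⟩ := huniq v r h
    exact ⟨_, hsys₀, fun p hp => ((hsys _ _ _).1 hp).1.2⟩
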